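/- For complex numbers $a,q$ write $(a;q)_n=\prod_{j=0}^{n-1}(1-aq^j)$ and, for $|q|<1$, $(a;q)_\infty=\prod_{j\ge 0}(1-aq^j)$, $(q)_\infty=(q;q)_\infty$ and $(a_1,\dots,a_r;q)_\infty=(a_1;q)_\infty\cdots(a_r;q)_\infty$. Let $q\in\mathbb C$ with $|q|<1$. For every integer $k\ge 1$, $$\sum_{n_1,\dots,n_k\ge 0}\frac{q^{N_1^2+\cdots+N_k^2+2N_k}\,(-q;q^2)_{n_k}}{(q^2;q^2)_{n_1}\cdots(q^2;q^2)_{n_{k-1}}\,(q^4;q^4)_{n_k}} =\frac{(-q;q^2)_\infty}{(q^2;q^2)_\infty}\,(q^{2k+4},q^k,q^{k+4};q^{2k+4})_\infty =\frac{(q^2;q^4)_\infty}{(q)_\infty}\,(q^{2k+4},q^k,q^{k+4};q^{2k+4})_\infty ,$$ where $N_i=n_i+n_{i+1}+\cdots+n_k$ for $1\le i\le k$ and the series converges absolutely. For $k=2$ the summand is $\dfrac{q^{n_1^2+2n_1n_2+2n_2^2+2n_2}(-q;q^2)_{n_2}}{(q^2;q^2)_{n_1}(q^4;q^4)_{n_2}}$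 and the right-hand side equals $(-q;q^2)_\infty(-q^4;q^4)_\infty$, so that $$\sum_{n_1,n_2\ge 0}\frac{q^{n_1^2+2n_1n_2+2n_2^2+2n_2}(-q;q^2)_{n_2}}{(q^2;q^2)_{n_1}(q^4;q^4)_{n_2}} =(-q;q^2)_\infty(-q^4;q^4)_\infty =(-q;q^4)_\infty(-q^3;q^4)_\infty(-q^4;q^4)_\infty =\sum_{m\ge 0}Q_2(m)\,q^m ,$$ where $Q_2(m)$ is the number of partitions of $m$ into distinct parts none of which is $\equiv 2\pmod 4$, and both series converge absolutely. -/

import Mathlib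

open Filter Topology

/-- The finite `q`-shifted factorial `(a; q)_n = ∏_{j=0}^{n-1} (1 - a q^j)`. -/
noncomputable def qPoch (a q : ℂ) (n : ℕ) : ℂ :=
  ∏ j ∈ Finset.range n, (1 - a * q ^ j)

/-- The infinite `q`-shifted factorial `(a; q)_∞ = ∏_{j≥0} (1 - a q^j)`, used for `‖q‖ < 1`. -/
noncomputable def qPochInf (a q : ℂ) : ℂ :=
  ∏' j : ℕ, (1 - a * q ^ j)

/-- The infinite product defining `(a; q)_∞` converges for every `a` when `‖q‖ < 1`. -/
theorem multipliable_qPochInf (a : ℂ) {q : ℂ} (hq : ‖q‖ < 1) :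
    Multipliable fun j : ℕ => 1 - a * q ^ j := by
  have h : Summable fun j : ℕ => ‖-(a * q ^ j)‖ := by
    simp only [norm_neg, norm_mul, norm_pow]
    exact (summable_geometric_of_lt_one (norm_nonneg q) hq).mul_left _
  simpa [sub_eq_add_neg] using multipliable_one_add_of_summable h

/-- `(a; q)_∞` is the limit of `(a; q)_n` when `‖q‖ < 1`. -/
theorem tendsto_qPoch (a : ℂ) {q : ℂ} (hq : ‖q‖ < 1) :
    Tendsto (qPoch a q) atTop (𝓝 (qPochInf a q)) :=
  (multipliable_qPochInf a hq).hasProd.tendsto_prod_nat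

/-- The partial sum `N_i = n_i + n_{i+1} + ⋯ + n_k` of `(n_1, …, n_k)`; the index `i` of the
text is the element `i - 1` of `Fin k`. -/
def tailSum {k : ℕ} (n : Fin k → ℕ) (i : Fin k) : ℕ :=
  ∑ j ∈ Finset.Ici i, n j

/-- The last index of `(n_1, …, n_k)`, i.e. the position of `n_k`. -/
def lastIdx (k : ℕ) (hk : 1 ≤ k) : Fin k :=
  ⟨k - 1, by omega⟩

/-- The summand
`q^{N_1² + ⋯ + N_k² + 2 N_k} (-q; q²)_{n_k} /
  ((q²; q²)_{n_1} ⋯ (q²; q²)_{n_{k-1}} (q⁴; q⁴)_{n_k})`. -/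
noncomputable def hierarchyTerm (k : ℕ) (hk : 1 ≤ k) (q : ℂ) (n : Fin k → ℕ) : ℂ :=
  q ^ ((∑ i, tailSum n i ^ 2) + 2 * tailSum n (lastIdx k hk)) *
      qPoch (-q) (q ^ 2) (n (lastIdx k hk)) /
    ((∏ i ∈ Finset.Iio (lastIdx k hk), qPoch (q ^ 2) (q ^ 2) (n i)) *
      qPoch (q ^ 4) (q ^ 4) (n (lastIdx k hk)))

/-- `Q_i(m)`: the number of partitions of `m` into distinct parts, none of them `≡ i (mod 4)`. -/
def distinctCount (i m : ℕ) : ℕ :=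
  (Finset.univ.filter fun p : Nat.Partition m =>
    p.parts.Nodup ∧ ∀ b ∈ p.parts, ¬ b ≡ i [MOD 4]).card

/-!
The identity is proved with the Bailey lemma in base `q²`, in the form relevant here. If a sequence
`B` has the shape `B_L = (-q; q²)_L ∑_r c_r / ((q²; q²)_{L-r} (q²; q²)_{L+r})`, then
`∑_{n ≤ L} q^{n²} B_n / (q²; q²)_{L-n}` has the same shape with `c_r` replaced by `q^{r²} c_r`
(`sum_mul_bilat`); interchanging the sums, this is the `q`-Chu–Vandermonde sum
(`sum_qChuVandermonde`) for each `r`. The factors `(-q; q²)_n` telescope, which is why only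
`(-q; q²)_{n_k}` is left in the multiple series.

The iteration starts from `B_L = q^{2L} (-q; q²)_L / (q⁴; q⁴)_L`, which has this shape with
`c_r = (-1)^r q^{2r² + 2r}` (`bilat_thetaTerm_self`). After `k` steps `c_r` has become
`(-1)^r q^{(k+2) r² + 2r}`. Summing the multiple series over all variables with `N_1` fixed gives
`q^{N_1²}` times the sequence after `k - 1` steps (`hasLevelSums_hierarchyTerm`), so the limit
`L → ∞` of the `k`-th step evaluates the series as
`(-q; q²)_∞ / (q²; q²)_∞ · ∑_r (-1)^r q^{(k+2) r² + 2r}` (`tsum_baileySeq`), and the Jacobi triple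
product (`tsum_thetaTerm`) turns the theta series into the product. The triple product is itself
the limit of a finite identity (`bilat_thetaTerm`) for the same kind of bilateral sum.

Exponents of the theta series are integers, so this argument needs `q ≠ 0`; for `q = 0` both sides
are `1`. For `k = 2` the product collapses by elementary manipulations, and the expansion of
`(-q; q⁴)_∞ (-q³; q⁴)_∞ (-q⁴; q⁴)_∞` over finite sets of exponents is the generating function of
partitions into distinct parts not congruent to `2` modulo `4` (`hasSum_distinctCount_two`).
-/

/-! ### Finite and infinite shifted factorials -/

lemma one_sub_mul_pow_ne_zero {a q : ℂ} (ha : ‖a‖ < 1) (hq : ‖q‖ < 1) (j : ℕ) :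
    1 - a * q ^ j ≠ 0 := by
  intro h
  have h1 : a * q ^ j = 1 := (sub_eq_zero.mp h).symm
  have h2 : ‖a‖ * ‖q‖ ^ j = 1 := by rw [← norm_pow, ← norm_mul, h1, norm_one]
  have h3 : ‖q‖ ^ j ≤ 1 := pow_le_one₀ (norm_nonneg q) hq.le
  nlinarith [norm_nonneg a]

lemma qPoch_ne_zero {a q : ℂ} (ha : ‖a‖ < 1) (hq : ‖q‖ < 1) (n : ℕ) : qPoch a q n ≠ 0 :=
  Finset.prod_ne_zero_iff.mpr fun j _ => one_sub_mul_pow_ne_zero ha hq j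

lemma qPochInf_ne_zero {a q : ℂ} (ha : ‖a‖ < 1) (hq : ‖q‖ < 1) : qPochInf a q ≠ 0 := by
  have h : Summable fun j : ℕ => ‖-(a * q ^ j)‖ := by
    simp only [norm_neg, norm_mul, norm_pow]
    exact (summable_geometric_of_lt_one (norm_nonneg q) hq).mul_left _
  have := tprod_one_add_ne_zero_of_summable (f := fun j : ℕ => -(a * q ^ j))
    (fun j => by
      rw [← sub_eq_add_neg]
      exact one_sub_mul_pow_ne_zero ha hq j) h
  simpa only [qPochInf, sub_eq_add_neg] using this

@[simp] lemma qPoch_zero (a q : ℂ) : qPoch a q 0 = 1 := by simp [qPoch]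

lemma qPoch_succ (a q : ℂ) (n : ℕ) : qPoch a q (n + 1) = qPoch a q n * (1 - a * q ^ n) :=
  Finset.prod_range_succ _ _

lemma qPoch_succ' (a q : ℂ) (n : ℕ) : qPoch a q (n + 1) = (1 - a) * qPoch (a * q) q n := by
  rw [qPoch, Finset.prod_range_succ', qPoch, mul_comm]
  simp only [pow_zero, mul_one, pow_succ']
  congr 1
  exact Finset.prod_congr rfl fun j _ => by ring

lemma qPoch_add (a q : ℂ) (m n : ℕ) :
    qPoch a q (m + n) = qPoch a q m * qPoch (a * q ^ m) q n := by
  rw [qPoch, Finset.prod_range_add]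
  exact congrArg _ (Finset.prod_congr rfl fun j _ => by ring)

/-- A finite shifted factorial is bounded uniformly in its length. -/
lemma exists_norm_qPoch_le (a : ℂ) {q : ℂ} (hq : ‖q‖ < 1) : ∃ C, ∀ n, ‖qPoch a q n‖ ≤ C := by
  obtain ⟨C, hC⟩ := (tendsto_qPoch a hq).norm.bddAbove_range
  exact ⟨C, fun n => hC ⟨n, rfl⟩⟩

/-- The reciprocal `1 / (P; P)_n`, extended by zero to negative integers `n`. -/
noncomputable def qInv (P : ℂ) (n : ℤ) : ℂ :=
  if 0 ≤ n then (qPoch P P n.toNat)⁻¹ else 0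

lemma qInv_of_neg (P : ℂ) {n : ℤ} (hn : n < 0) : qInv P n = 0 := by
  simp [qInv, not_le.mpr hn]

@[simp] lemma qInv_natCast (P : ℂ) (n : ℕ) : qInv P n = (qPoch P P n)⁻¹ := by simp [qInv]

@[simp] lemma qInv_zero (P : ℂ) : qInv P 0 = 1 := by simp [qInv]

/-- The recursion of `1 / (P; P)_n` persists at `n = 0`, where both sides vanish, and below. -/
lemma qInv_sub_one {P : ℂ} (hP : ‖P‖ < 1) (n : ℤ) :
    qInv P (n - 1) = (1 - P ^ n) * qInv P n := by
  rcases lt_trichotomy n 0 with h | rfl | h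
  · rw [qInv_of_neg P h, qInv_of_neg P (by omega), mul_zero]
  · rw [qInv_of_neg P (by omega)]; simp
  · obtain ⟨m, rfl⟩ : ∃ m : ℕ, n = (m : ℤ) + 1 := ⟨(n - 1).toNat, by omega⟩
    have h1 : qInv P ((m : ℤ) + 1) = (qPoch P P (m + 1))⁻¹ := by
      rw [← qInv_natCast]; push_cast; rfl
    have h2 := one_sub_mul_pow_ne_zero hP hP m
    have h3 := qPoch_ne_zero hP hP m
    rw [h1, add_sub_cancel_right, qInv_natCast, qPoch_succ]
    have h4 : P ^ ((m : ℤ) + 1) = P * P ^ m := by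
      rw [← pow_succ', ← zpow_natCast]; push_cast; rfl
    rw [h4]
    field_simp

lemma tendsto_qInv {P : ℂ} (hP : ‖P‖ < 1) :
    Tendsto (fun n : ℕ => qInv P n) atTop (𝓝 (qPochInf P P)⁻¹) := by
  simp only [qInv_natCast]
  exact (tendsto_qPoch P hP).inv₀ (qPochInf_ne_zero hP hP)

lemma tendsto_qInv_atTop {P : ℂ} (hP : ‖P‖ < 1) :
    Tendsto (qInv P) atTop (𝓝 (qPochInf P P)⁻¹) := by
  rw [← Nat.map_cast_int_atTop]
  exact tendsto_map'_iff.mpr (tendsto_qInv hP)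

lemma exists_norm_qInv_le {P : ℂ} (hP : ‖P‖ < 1) : ∃ C, ∀ n, ‖qInv P n‖ ≤ C := by
  obtain ⟨C, hC⟩ := (tendsto_qInv hP).norm.bddAbove_range
  refine ⟨C, fun n => ?_⟩
  have h0 : ∀ m : ℕ, ‖qInv P m‖ ≤ C := fun m => hC ⟨m, rfl⟩
  rcases lt_or_ge n 0 with h | h
  · rw [qInv_of_neg P h, norm_zero]
    exact (norm_nonneg _).trans (h0 0)
  · obtain ⟨m, rfl⟩ := Int.eq_ofNat_of_zero_le h
    exact h0 m

/-! ### Bilateral sums weighted by reciprocal shifted factorials -/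

/-- The finite sum `∑_r c_r / ((P; P)_{L - r} (P; P)_{M + r})` over all integers `r`; only
`-M ≤ r ≤ L` contribute. -/
noncomputable def bilat (P : ℂ) (c : ℤ → ℂ) (L M : ℤ) : ℂ :=
  ∑' r : ℤ, c r * (qInv P (L - r) * qInv P (M + r))

lemma summable_bilat (P : ℂ) (c : ℤ → ℂ) (L M : ℤ) :
    Summable fun r : ℤ => c r * (qInv P (L - r) * qInv P (M + r)) := by
  refine summable_of_ne_finset_zero (s := Finset.Icc (-M) L) fun r hr => ?_
  rw [Finset.mem_Icc, not_and_or, not_le, not_le] at hr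
  rcases hr with h | h
  · rw [qInv_of_neg P (show M + r < 0 by omega)]; ring
  · rw [qInv_of_neg P (show L - r < 0 by omega)]; ring

lemma bilat_const_mul (P a : ℂ) (c : ℤ → ℂ) (L M : ℤ) :
    bilat P (fun r => a * c r) L M = a * bilat P c L M := by
  simp only [bilat, mul_assoc, tsum_mul_left]

lemma bilat_sub (P : ℂ) (c d : ℤ → ℂ) (L M : ℤ) :
    bilat P (fun r => c r - d r) L M = bilat P c L M - bilat P d L M := by
  rw [bilat, bilat, bilat, ← (summable_bilat P c L M).tsum_sub (summable_bilat P d L M)]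
  exact tsum_congr fun r => by ring

lemma bilat_add (P : ℂ) (c d : ℤ → ℂ) (L M : ℤ) :
    bilat P (fun r => c r + d r) L M = bilat P c L M + bilat P d L M := by
  rw [bilat, bilat, bilat, ← (summable_bilat P c L M).tsum_add (summable_bilat P d L M)]
  exact tsum_congr fun r => by ring

lemma bilat_shift (P : ℂ) (c : ℤ → ℂ) (L M k : ℤ) :
    bilat P c L M = bilat P (fun r => c (r + k)) (L - k) (M + k) := by
  rw [bilat, bilat, ← (Equiv.addRight k).tsum_eq]
  refine tsum_congr fun r => ?_
  simp only [Equiv.coe_addRight]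
  rw [show L - (r + k) = L - k - r by ring, show M + (r + k) = M + k + r by ring]

lemma bilat_neg (P : ℂ) (c : ℤ → ℂ) (L M : ℤ) :
    bilat P c L M = bilat P (fun r => c (-r)) M L := by
  rw [bilat, bilat, ← (Equiv.neg ℤ).tsum_eq]
  refine tsum_congr fun r => ?_
  simp only [Equiv.neg_apply, sub_neg_eq_add, ← sub_eq_add_neg]
  ring

lemma bilat_sub_one_left {P : ℂ} (hP : ‖P‖ < 1) (c : ℤ → ℂ) (L M : ℤ) :
    bilat P c (L - 1) M = bilat P (fun r => (1 - P ^ (L - r)) * c r) L M := by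
  refine tsum_congr fun r => ?_
  rw [show L - 1 - r = L - r - 1 by ring, qInv_sub_one hP]
  ring

lemma bilat_sub_one_right {P : ℂ} (hP : ‖P‖ < 1) (c : ℤ → ℂ) (L M : ℤ) :
    bilat P c L (M - 1) = bilat P (fun r => (1 - P ^ (M + r)) * c r) L M := by
  refine tsum_congr fun r => ?_
  rw [show M - 1 + r = M + r - 1 by ring, qInv_sub_one hP]
  ring

/-- The `q`-Pascal rule `1 - P^{L+M} = (1 - P^{M+r}) + P^{M+r} (1 - P^{L-r})`, summed over `r`. -/
lemma one_sub_zpow_mul_bilat {P : ℂ} (hP : ‖P‖ < 1) (hP0 : P ≠ 0) (c : ℤ → ℂ) (L M : ℤ) :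
    (1 - P ^ (L + M)) * bilat P c L M =
      bilat P c L (M - 1) + bilat P (fun r => P ^ (M + r) * c r) (L - 1) M := by
  rw [bilat_sub_one_left hP, bilat_sub_one_right hP, ← bilat_add, ← bilat_const_mul]
  congr 1
  funext r
  rw [show L + M = (M + r) + (L - r) by ring, zpow_add₀ hP0]
  ring

/-- The mirror image `1 - P^{L+M} = (1 - P^{L-r}) + P^{L-r} (1 - P^{M+r})` of the `q`-Pascal
rule. -/
lemma one_sub_zpow_mul_bilat' {P : ℂ} (hP : ‖P‖ < 1) (hP0 : P ≠ 0) (c : ℤ → ℂ) (L M : ℤ) :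
    (1 - P ^ (L + M)) * bilat P c L M =
      bilat P c (L - 1) M + bilat P (fun r => P ^ (L - r) * c r) L (M - 1) := by
  rw [bilat_sub_one_left hP, bilat_sub_one_right hP, ← bilat_add, ← bilat_const_mul]
  congr 1
  funext r
  rw [show L + M = (M + r) + (L - r) by ring, zpow_add₀ hP0]
  ring

lemma bilat_zero_zero (P : ℂ) (c : ℤ → ℂ) : bilat P c 0 0 = c 0 := by
  rw [bilat, tsum_eq_single 0]
  · simp
  · intro r hr
    rcases lt_or_gt_of_ne hr with h | h
    · rw [qInv_of_neg P (show 0 + r < 0 by omega)]; ring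
    · rw [qInv_of_neg P (show 0 - r < 0 by omega)]; ring

/-- For an absolutely summable weight the finite bilateral sums converge, by dominated
convergence, to the full sum of the weight divided by `(P; P)_∞²`. -/
lemma tendsto_bilat {P : ℂ} (hP : ‖P‖ < 1) {c : ℤ → ℂ} (hc : Summable fun r => ‖c r‖) :
    Tendsto (fun L : ℕ => bilat P c L L) atTop
      (𝓝 ((∑' r, c r) * ((qPochInf P P)⁻¹ * (qPochInf P P)⁻¹))) := by
  obtain ⟨C, hC⟩ := exists_norm_qInv_le hP
  rw [← tsum_mul_right]
  refine tendsto_tsum_of_dominated_convergence (bound := fun r => ‖c r‖ * (C * C))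
    (hc.mul_right _) (fun r => ?_) (Eventually.of_forall fun L r => ?_)
  · refine Tendsto.const_mul _ (Tendsto.mul ?_ ?_)
    · exact (tendsto_qInv_atTop hP).comp
        (tendsto_atTop_add_const_right _ (-r) tendsto_natCast_atTop_atTop)
    · exact (tendsto_qInv_atTop hP).comp
        (tendsto_atTop_add_const_right _ r tendsto_natCast_atTop_atTop)
  · rw [norm_mul, norm_mul]
    have := (norm_nonneg _).trans (hC 0)
    gcongr <;> exact hC _

/-! ### The Jacobi triple product -/

/-- The general term `(-1)^r p^{r²} z^r` of the theta series. -/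
noncomputable def thetaTerm (p z : ℂ) (r : ℤ) : ℂ := (-1) ^ r * p ^ (r ^ 2) * z ^ r

lemma neg_one_zpow_add_one (r : ℤ) : (-1 : ℂ) ^ (r + 1) = -(-1) ^ r := by
  rw [zpow_add_one₀ (by norm_num)]; ring

lemma neg_one_zpow_neg (r : ℤ) : (-1 : ℂ) ^ (-r) = (-1) ^ r := by
  rw [zpow_neg, ← inv_zpow]; norm_num

/-- The finite form of the triple product, with base `P = p²`. -/
lemma bilat_thetaTerm {p z : ℂ} (hp : ‖p‖ < 1) (hp0 : p ≠ 0) (hz : z ≠ 0) (L : ℕ) :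
    qPoch (p ^ 2) (p ^ 2) (2 * L) * bilat (p ^ 2) (thetaTerm p z) L L =
      qPoch (p * z) (p ^ 2) L * qPoch (p / z) (p ^ 2) L := by
  have hP : ‖p ^ 2‖ < 1 := by
    rw [norm_pow]; exact pow_lt_one₀ (norm_nonneg p) hp two_ne_zero
  have hP0 : p ^ 2 ≠ 0 := pow_ne_zero 2 hp0
  induction L with
  | zero => simp [bilat_zero_zero, thetaTerm]
  | succ L ih =>
    -- lowering the first and then the second length by one; in each step the two halves of the
    -- `q`-Pascal rule agree up to a translation of `r`
    have h1 : (1 - (p ^ 2) ^ (2 * L + 1) * p ^ 2) * bilat (p ^ 2) (thetaTerm p z) (L + 1) (L + 1) =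
        (1 - p / z * (p ^ 2) ^ L) * bilat (p ^ 2) (thetaTerm p z) (L + 1) L := by
      have h := one_sub_zpow_mul_bilat hP hP0 (thetaTerm p z) (L + 1) (L + 1)
      have e : bilat (p ^ 2) (fun r => (p ^ 2) ^ ((L : ℤ) + 1 + r) * thetaTerm p z r)
          ((L : ℤ) + 1 - 1) (L + 1) =
          bilat (p ^ 2) (fun r => -(p / z * (p ^ 2) ^ L) * thetaTerm p z r) (L + 1) L := by
        rw [bilat_shift _ _ (L + 1) L 1]
        congr 1
        funext r
        simp only [thetaTerm, neg_one_zpow_add_one, ← zpow_natCast, ← zpow_mul]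
        rw [show (r + 1) ^ 2 = r ^ 2 + (2 * r + 1) by ring, zpow_add₀ hp0 (r ^ 2),
          zpow_add_one₀ hz]
        have : p ^ ((2 : ℕ) * ((L : ℤ) + 1 + r)) =
            p * p ^ ((2 : ℕ) * (L : ℤ)) * p ^ (2 * r + 1) := by
          rw [← zpow_one_add₀ hp0, ← zpow_add₀ hp0]; congr 1; push_cast; ring
        rw [this]
        field_simp
      rw [e, bilat_const_mul, add_sub_cancel_right] at h
      have e2 : (p ^ 2) ^ ((L : ℤ) + 1 + (L + 1)) = (p ^ 2) ^ (2 * L + 1) * p ^ 2 := by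
        rw [← pow_succ, ← zpow_natCast (p ^ 2)]; congr 1; push_cast; ring
      rw [e2] at h
      rw [h]; ring
    have h2 : (1 - (p ^ 2) ^ (2 * L) * p ^ 2) * bilat (p ^ 2) (thetaTerm p z) (L + 1) L =
        (1 - p * z * (p ^ 2) ^ L) * bilat (p ^ 2) (thetaTerm p z) L L := by
      have h := one_sub_zpow_mul_bilat' hP hP0 (thetaTerm p z) (L + 1) L
      have e : bilat (p ^ 2) (fun r => (p ^ 2) ^ ((L : ℤ) + 1 - r) * thetaTerm p z r)
          (L + 1) ((L : ℤ) - 1) =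
          bilat (p ^ 2) (fun r => -(p * z * (p ^ 2) ^ L) * thetaTerm p z r) L L := by
        rw [bilat_shift _ _ (L + 1) (L - 1) 1, add_sub_cancel_right, sub_add_cancel]
        congr 1
        funext r
        simp only [thetaTerm, neg_one_zpow_add_one, ← zpow_natCast, ← zpow_mul]
        rw [show (r + 1) ^ 2 = r ^ 2 + (2 * r + 1) by ring, zpow_add₀ hp0 (r ^ 2),
          zpow_add_one₀ hz]
        have : p ^ ((2 : ℕ) * ((L : ℤ) + 1 - (r + 1))) * p ^ (2 * r + 1) =
            p * p ^ ((2 : ℕ) * (L : ℤ)) := by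
          rw [← zpow_one_add₀ hp0, ← zpow_add₀ hp0]; congr 1; push_cast; ring
        linear_combination (-(-1) ^ r * p ^ r ^ 2 * z ^ r * z) * this
      rw [e, bilat_const_mul, add_sub_cancel_right] at h
      have e2 : (p ^ 2) ^ ((L : ℤ) + 1 + L) = (p ^ 2) ^ (2 * L) * p ^ 2 := by
        rw [← pow_succ, ← zpow_natCast (p ^ 2)]; congr 1; push_cast; ring
      rw [e2] at h
      rw [h]; ring
    rw [show 2 * (L + 1) = 2 * L + 1 + 1 by ring, qPoch_succ, qPoch_succ, qPoch_succ, qPoch_succ]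
    push_cast
    rw [show p ^ 2 * (p ^ 2) ^ (2 * L + 1) = (p ^ 2) ^ (2 * L + 1) * p ^ 2 by ring,
      show p ^ 2 * (p ^ 2) ^ (2 * L) = (p ^ 2) ^ (2 * L) * p ^ 2 by ring]
    linear_combination (qPoch (p ^ 2) (p ^ 2) (2 * L) * (1 - (p ^ 2) ^ (2 * L) * p ^ 2)) * h1 +
      (qPoch (p ^ 2) (p ^ 2) (2 * L) * (1 - p / z * (p ^ 2) ^ L)) * h2 +
      ((1 - p / z * (p ^ 2) ^ L) * (1 - p * z * (p ^ 2) ^ L)) * ih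

/-- The Jacobi triple product, as the limit of its finite form. -/
lemma tsum_thetaTerm {p z : ℂ} (hp : ‖p‖ < 1) (hp0 : p ≠ 0) (hz : z ≠ 0)
    (hs : Summable fun r => ‖thetaTerm p z r‖) :
    ∑' r, thetaTerm p z r =
      qPochInf (p ^ 2) (p ^ 2) * qPochInf (p / z) (p ^ 2) * qPochInf (p * z) (p ^ 2) := by
  have hP : ‖p ^ 2‖ < 1 := by
    rw [norm_pow]; exact pow_lt_one₀ (norm_nonneg p) hp two_ne_zero
  have h1 := ((tendsto_qPoch (p ^ 2) hP).comp
    (tendsto_id.const_mul_atTop' (two_pos : 0 < 2))).mul (tendsto_bilat hP hs)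
  have h2 := (tendsto_qPoch (p * z) hP).mul (tendsto_qPoch (p / z) hP)
  have h3 := tendsto_nhds_unique (h1.congr fun L => by
    simpa using bilat_thetaTerm hp hp0 hz L) h2
  have h4 := qPochInf_ne_zero hP hP
  field_simp at h3
  rw [h3]; ring

/-! ### The Bailey pair that starts the iteration -/

/-- The sum is odd under the reflection `r ↦ 1 - r`. -/
lemma bilat_reflect_eq_zero {Q : ℂ} (hQ0 : Q ≠ 0) (L : ℤ) :
    bilat Q (fun r => Q ^ (-r) * thetaTerm Q 1 r) L (L - 1) = 0 := by
  have h : bilat Q (fun r => Q ^ (-r) * thetaTerm Q 1 r) L (L - 1) =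
      bilat Q (fun r => -1 * (Q ^ (-r) * thetaTerm Q 1 r)) L (L - 1) := by
    rw [bilat_shift _ _ L (L - 1) 1, bilat_neg, sub_add_cancel]
    congr 1
    funext r
    simp only [thetaTerm, neg_one_zpow_add_one, neg_one_zpow_neg, one_zpow, mul_one]
    have : Q ^ (-(-r + 1)) * Q ^ ((-r + 1) ^ 2) = Q ^ (-r) * Q ^ (r ^ 2) := by
      rw [← zpow_add₀ hQ0, ← zpow_add₀ hQ0]; congr 1; ring
    linear_combination (-(-1) ^ r) * this
  rw [bilat_const_mul] at h
  linear_combination h / 2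

lemma bilat_reflect_left {Q : ℂ} (hQ : ‖Q‖ < 1) (hQ0 : Q ≠ 0) (L : ℤ) :
    bilat Q (thetaTerm Q 1) L (L - 1) = bilat Q (thetaTerm Q 1) (L - 1) (L - 1) := by
  have h : bilat Q (thetaTerm Q 1) (L - 1) (L - 1) = bilat Q (thetaTerm Q 1) L (L - 1) -
      Q ^ L * bilat Q (fun r => Q ^ (-r) * thetaTerm Q 1 r) L (L - 1) := by
    rw [bilat_sub_one_left hQ, ← bilat_const_mul, ← bilat_sub]
    congr 1
    funext r
    rw [sub_eq_add_neg L, zpow_add₀ hQ0]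
    ring
  rw [h, bilat_reflect_eq_zero hQ0, mul_zero, sub_zero]

/-- `∑_r (-1)^r Q^{r²} / ((Q)_{L-r} (Q)_{L+r}) = 1 / (Q²; Q²)_L`. -/
lemma bilat_thetaTerm_one {Q : ℂ} (hQ : ‖Q‖ < 1) (hQ0 : Q ≠ 0) (L : ℕ) :
    bilat Q (thetaTerm Q 1) L L = (qPoch (Q ^ 2) (Q ^ 2) L)⁻¹ := by
  have hQ2 : ‖Q ^ 2‖ < 1 := by
    rw [norm_pow]; exact pow_lt_one₀ (norm_nonneg Q) hQ two_ne_zero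
  induction L with
  | zero => simp [bilat_zero_zero, thetaTerm]
  | succ L ih =>
    have h := one_sub_zpow_mul_bilat hQ hQ0 (thetaTerm Q 1) (L + 1) (L + 1)
    have e : bilat Q (fun r => Q ^ ((L : ℤ) + 1 + r) * thetaTerm Q 1 r)
        ((L : ℤ) + 1 - 1) (L + 1) = 0 := by
      rw [bilat_neg]
      have : (fun r : ℤ => Q ^ ((L : ℤ) + 1 + -r) * thetaTerm Q 1 (-r)) =
          fun r => Q ^ ((L : ℤ) + 1) * (Q ^ (-r) * thetaTerm Q 1 r) := by
        funext r
        simp only [thetaTerm, neg_one_zpow_neg, neg_sq, one_zpow]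
        rw [zpow_add₀ hQ0 (L + 1)]; ring
      rw [this, bilat_const_mul, bilat_reflect_eq_zero hQ0, mul_zero]
    rw [e, add_zero, bilat_reflect_left hQ hQ0, add_sub_cancel_right, ih] at h
    have h2 := one_sub_mul_pow_ne_zero hQ2 hQ2 L
    have h3 := qPoch_ne_zero hQ2 hQ2 L
    have e2 : Q ^ ((L : ℤ) + 1 + (L + 1)) = Q ^ 2 * (Q ^ 2) ^ L := by
      rw [← pow_succ', ← pow_mul, ← zpow_natCast]; congr 1; push_cast; ring
    rw [e2] at h
    rw [qPoch_succ, mul_inv, ← h]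
    push_cast
    field_simp

/-- `∑_r (-1)^r Q^{r² + r} / ((Q)_{L-r} (Q)_{L+r}) = Q^L / (Q²; Q²)_L`. -/
lemma bilat_thetaTerm_self {Q : ℂ} (hQ : ‖Q‖ < 1) (hQ0 : Q ≠ 0) (L : ℕ) :
    bilat Q (thetaTerm Q Q) L L = Q ^ L * (qPoch (Q ^ 2) (Q ^ 2) L)⁻¹ := by
  rw [← bilat_thetaTerm_one hQ hQ0]
  have h : bilat Q (thetaTerm Q 1) L (L - 1) = bilat Q (thetaTerm Q 1) L L -
      Q ^ L * bilat Q (thetaTerm Q Q) L L := by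
    rw [bilat_sub_one_right hQ, ← bilat_const_mul, ← bilat_sub]
    congr 1
    funext r
    simp only [thetaTerm, one_zpow, zpow_add₀ hQ0, zpow_natCast]
    ring
  have h1 : bilat Q (thetaTerm Q 1) L (L - 1) =
      (1 - (Q ^ 2) ^ L) * bilat Q (thetaTerm Q 1) L L := by
    -- both `L ↦ bilat … L L` and its predecessor are known, up to the empty case `L = 0`
    rw [bilat_reflect_left hQ hQ0]
    rcases L with _ | L
    · have : bilat Q (thetaTerm Q 1) ((0 : ℕ) - 1) ((0 : ℕ) - 1) = 0 := by
        refine (tsum_congr fun r => ?_).trans tsum_zero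
        rcases lt_or_ge r 0 with hr | hr
        · rw [qInv_of_neg Q (show ((0 : ℕ) : ℤ) - 1 + r < 0 by push_cast; omega)]; ring
        · rw [qInv_of_neg Q (show ((0 : ℕ) : ℤ) - 1 - r < 0 by push_cast; omega)]; ring
      rw [this]; simp
    · have hQ2 : ‖Q ^ 2‖ < 1 := by
        rw [norm_pow]; exact pow_lt_one₀ (norm_nonneg Q) hQ two_ne_zero
      have h2 := one_sub_mul_pow_ne_zero hQ2 hQ2 L
      have h3 := qPoch_ne_zero hQ2 hQ2 L
      rw [bilat_thetaTerm_one hQ hQ0 (L + 1), qPoch_succ]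
      rw [show ((L + 1 : ℕ) : ℤ) - 1 = L by push_cast; ring, bilat_thetaTerm_one hQ hQ0 L,
        pow_succ']
      field_simp
      ring
  have h4 : Q ^ L * (bilat Q (thetaTerm Q Q) L L) =
      Q ^ L * (Q ^ L * bilat Q (thetaTerm Q 1) L L) := by
    linear_combination h - h1
  exact mul_left_cancel₀ (pow_ne_zero L hQ0) h4

/-! ### The `q`-Chu–Vandermonde sum and the Bailey step -/

/-- A form of the `q`-Chu–Vandermonde sum that is polynomial in `b` and `x`. -/
lemma sum_qChuVandermonde {q : ℂ} (hq : ‖q‖ < 1) (b x : ℂ) (M : ℕ) :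
    ∑ m ∈ Finset.range (M + 1), (-x) ^ m * q ^ (m.choose 2) * qPoch b q m *
        qPoch (b * x * q ^ m) q (M - m) * (qInv q m * qInv q ((M : ℤ) - m)) =
      qPoch x q M * qInv q M := by
  induction M generalizing b with
  | zero => simp
  | succ M ih =>
    -- multiply by `1 - q ^ (M + 1)` and apply the `q`-Pascal rule to the weights
    have hne : (1 : ℂ) - q * q ^ M ≠ 0 := one_sub_mul_pow_ne_zero hq hq M
    have pascal : ∀ m ∈ Finset.range (M + 1 + 1),
        (1 - q * q ^ M) * (qInv q m * qInv q (((M + 1 : ℕ) : ℤ) - m)) =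
          qInv q m * qInv q ((M : ℤ) - m) +
          q ^ (M + 1 - m) * (qInv q ((m : ℤ) - 1) * qInv q (((M + 1 : ℕ) : ℤ) - m)) := by
      intro m hm
      have hm' : m ≤ M + 1 := by simpa [Nat.lt_succ_iff] using hm
      rw [show (M : ℤ) - m = ((M + 1 : ℕ) : ℤ) - m - 1 by push_cast; ring, qInv_sub_one hq,
        qInv_sub_one hq, ← Nat.cast_sub hm', zpow_natCast, zpow_natCast]
      have : q * q ^ M = q ^ (M + 1 - m) * q ^ m := by
        rw [← pow_succ', ← pow_add, Nat.sub_add_cancel hm']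
      rw [this]; ring
    have hM : qInv q (M : ℤ) = (1 - q * q ^ M) * qInv q ((M + 1 : ℕ) : ℤ) := by
      have := qInv_sub_one hq ((M + 1 : ℕ) : ℤ)
      rw [zpow_natCast, pow_succ'] at this
      rw [← this]; congr 1; push_cast; ring
    apply mul_left_cancel₀ hne
    rw [Finset.mul_sum]
    have split : ∀ m ∈ Finset.range (M + 1 + 1),
        (1 - q * q ^ M) * ((-x) ^ m * q ^ (m.choose 2) * qPoch b q m *
          qPoch (b * x * q ^ m) q (M + 1 - m) *
            (qInv q m * qInv q (((M + 1 : ℕ) : ℤ) - m))) =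
        (-x) ^ m * q ^ (m.choose 2) * qPoch b q m *
          qPoch (b * x * q ^ m) q (M + 1 - m) * (qInv q m * qInv q ((M : ℤ) - m)) +
        (-x) ^ m * q ^ (m.choose 2) * qPoch b q m *
          qPoch (b * x * q ^ m) q (M + 1 - m) *
            (q ^ (M + 1 - m) * (qInv q ((m : ℤ) - 1) * qInv q (((M + 1 : ℕ) : ℤ) - m))) := by
      intro m hm
      linear_combination ((-x) ^ m * q ^ (m.choose 2) * qPoch b q m *
          qPoch (b * x * q ^ m) q (M + 1 - m)) * pascal m hm
    rw [Finset.sum_congr rfl split, Finset.sum_add_distrib]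
    have first : ∑ m ∈ Finset.range (M + 1 + 1), (-x) ^ m * q ^ (m.choose 2) * qPoch b q m *
          qPoch (b * x * q ^ m) q (M + 1 - m) * (qInv q m * qInv q ((M : ℤ) - m)) =
        (1 - b * x * q ^ M) * (qPoch x q M * qInv q M) := by
      rw [Finset.sum_range_succ, qInv_of_neg q (show (M : ℤ) - ((M + 1 : ℕ) : ℤ) < 0 by
        push_cast; omega), mul_zero, mul_zero, add_zero, ← ih b, Finset.mul_sum]
      refine Finset.sum_congr rfl fun m hm => ?_
      have hm' : m ≤ M := by simpa [Nat.lt_succ_iff] using hm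
      rw [show M + 1 - m = (M - m) + 1 by omega, qPoch_succ]
      have : b * x * q ^ M = b * x * q ^ m * q ^ (M - m) := by
        rw [mul_assoc (b * x), ← pow_add, Nat.add_sub_cancel' hm']
      rw [this]; ring
    have second : ∑ m ∈ Finset.range (M + 1 + 1), (-x) ^ m * q ^ (m.choose 2) * qPoch b q m *
          qPoch (b * x * q ^ m) q (M + 1 - m) *
            (q ^ (M + 1 - m) * (qInv q ((m : ℤ) - 1) * qInv q (((M + 1 : ℕ) : ℤ) - m))) =
        -(x * q ^ M * (1 - b)) * (qPoch x q M * qInv q M) := by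
      rw [Finset.sum_range_succ', qInv_of_neg q (show ((0 : ℕ) : ℤ) - 1 < 0 by omega), zero_mul,
        mul_zero, mul_zero, add_zero, ← ih (b * q), Finset.mul_sum]
      refine Finset.sum_congr rfl fun m hm => ?_
      have hm' : m ≤ M := by simpa [Nat.lt_succ_iff] using hm
      rw [show M + 1 - (m + 1) = M - m by omega, qPoch_succ',
        show ((m + 1 : ℕ) : ℤ) - 1 = m by push_cast; ring,
        show ((M + 1 : ℕ) : ℤ) - ((m + 1 : ℕ) : ℤ) = (M : ℤ) - m by push_cast; ring,
        show (m + 1).choose 2 = m + m.choose 2 by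
          rw [Nat.choose_succ_succ' m 1, Nat.choose_one_right],
        show b * x * q ^ (m + 1) = b * q * x * q ^ m by ring]
      have : q ^ M = q ^ m * q ^ (M - m) := by rw [← pow_add, Nat.add_sub_cancel' hm']
      rw [this]; ring
    rw [first, second, qPoch_succ, hM]
    ring

/-- The Bailey step for one index `r ≥ 0`. -/
lemma sum_bailey_nat {q : ℂ} (hq : ‖q‖ < 1) (L r : ℕ) :
    ∑ n ∈ Finset.range (L + 1), q ^ (n ^ 2) * qPoch (-q) (q ^ 2) n * qInv (q ^ 2) ((L : ℤ) - n) *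
        (qInv (q ^ 2) ((n : ℤ) - r) * qInv (q ^ 2) ((n : ℤ) + r)) =
      qPoch (-q) (q ^ 2) L * q ^ (r ^ 2) *
        (qInv (q ^ 2) ((L : ℤ) - r) * qInv (q ^ 2) ((L : ℤ) + r)) := by
  have hQ : ‖q ^ 2‖ < 1 := by
    rw [norm_pow]; exact pow_lt_one₀ (norm_nonneg q) hq two_ne_zero
  rcases lt_or_ge L r with h | h
  · rw [qInv_of_neg _ (show (L : ℤ) - r < 0 by omega)]
    rw [Finset.sum_eq_zero]
    · ring
    · intro n hn
      have : n < L + 1 := Finset.mem_range.mp hn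
      rw [qInv_of_neg _ (show (n : ℤ) - r < 0 by omega)]; ring
  · obtain ⟨M, rfl⟩ := Nat.exists_eq_add_of_le h
    rw [add_assoc, Finset.sum_range_add, Finset.sum_eq_zero, zero_add]
    · have key := sum_qChuVandermonde hQ (-q * (q ^ 2) ^ r) (-q * (q ^ 2) ^ r) M
      have hfac : ∀ m : ℕ, qPoch (q ^ 2) (q ^ 2) (2 * r + m) * qInv (q ^ 2) ((2 * r + m : ℕ) : ℤ)
          = 1 := fun m => by
        rw [qInv_natCast, mul_inv_cancel₀ (qPoch_ne_zero hQ hQ _)]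
      have step : ∀ m ∈ Finset.range (M + 1),
          q ^ ((r + m) ^ 2) * qPoch (-q) (q ^ 2) (r + m) *
            qInv (q ^ 2) (((r + M : ℕ) : ℤ) - ((r + m : ℕ) : ℤ)) *
            (qInv (q ^ 2) (((r + m : ℕ) : ℤ) - r) * qInv (q ^ 2) (((r + m : ℕ) : ℤ) + r)) =
          q ^ (r ^ 2) * qPoch (-q) (q ^ 2) r * qInv (q ^ 2) ((2 * r + M : ℕ) : ℤ) *
          ((-(-q * (q ^ 2) ^ r)) ^ m * (q ^ 2) ^ (m.choose 2) *
            qPoch (-q * (q ^ 2) ^ r) (q ^ 2) m *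
            qPoch (-q * (q ^ 2) ^ r * (-q * (q ^ 2) ^ r) * (q ^ 2) ^ m) (q ^ 2) (M - m) *
            (qInv (q ^ 2) m * qInv (q ^ 2) ((M : ℤ) - m))) := by
        intro m hm
        have hm' : m ≤ M := by simpa [Nat.lt_succ_iff] using hm
        rw [show ((r + M : ℕ) : ℤ) - ((r + m : ℕ) : ℤ) = (M : ℤ) - m by push_cast; ring,
          show ((r + m : ℕ) : ℤ) - r = m by push_cast; ring,
          show ((r + m : ℕ) : ℤ) + r = ((2 * r + m : ℕ) : ℤ) by push_cast; ring, qPoch_add]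
        have e1 : qInv (q ^ 2) ((2 * r + m : ℕ) : ℤ) =
            qInv (q ^ 2) ((2 * r + M : ℕ) : ℤ) *
              qPoch (-q * (q ^ 2) ^ r * (-q * (q ^ 2) ^ r) * (q ^ 2) ^ m) (q ^ 2) (M - m) := by
          have h1 := hfac M
          have h2 := hfac m
          rw [show 2 * r + M = (2 * r + m) + (M - m) by omega, qPoch_add] at h1
          rw [show (2 * r + m) + (M - m) = 2 * r + M by omega] at h1
          have h3 : q ^ 2 * (q ^ 2) ^ (2 * r + m) =
              -q * (q ^ 2) ^ r * (-q * (q ^ 2) ^ r) * (q ^ 2) ^ m := by ring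
          rw [h3] at h1
          linear_combination (-qInv (q ^ 2) ((2 * r + m : ℕ) : ℤ)) * h1 +
            (qInv (q ^ 2) ((2 * r + M : ℕ) : ℤ) *
              qPoch (-q * (q ^ 2) ^ r * (-q * (q ^ 2) ^ r) * (q ^ 2) ^ m) (q ^ 2) (M - m)) * h2
        have e2 : q ^ ((r + m) ^ 2) =
            q ^ (r ^ 2) * ((-(-q * (q ^ 2) ^ r)) ^ m * (q ^ 2) ^ (m.choose 2)) := by
          have h3 : 2 * m.choose 2 + m = m ^ 2 := by
            rw [Nat.choose_two_right, Nat.mul_div_cancel' (Nat.even_mul_pred_self m).two_dvd]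
            rcases m with _ | m
            · rfl
            · simp only [Nat.add_sub_cancel]; ring
          rw [show (r + m) ^ 2 = r ^ 2 + ((2 * m.choose 2 + m) + 2 * r * m) by rw [h3]; ring]
          rw [pow_add, pow_add, pow_add, pow_mul q 2, neg_mul, neg_neg, mul_pow, ← pow_mul q 2 r,
            ← pow_mul]
          ring
        rw [e1, e2]; ring
      rw [Finset.sum_congr rfl step, ← Finset.mul_sum, key]
      rw [qPoch_add (-q) (q ^ 2) r M,
        show ((r + M : ℕ) : ℤ) - r = M by push_cast; ring,
        show ((r + M : ℕ) : ℤ) + r = ((2 * r + M : ℕ) : ℤ) by push_cast; ring]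
      ring
    · intro n hn
      have : n < r := Finset.mem_range.mp hn
      rw [qInv_of_neg _ (show (n : ℤ) - r < 0 by omega)]; ring

lemma sum_bailey {q : ℂ} (hq : ‖q‖ < 1) (L : ℕ) (r : ℤ) :
    ∑ n ∈ Finset.range (L + 1), q ^ (n ^ 2) * qPoch (-q) (q ^ 2) n * qInv (q ^ 2) ((L : ℤ) - n) *
        (qInv (q ^ 2) ((n : ℤ) - r) * qInv (q ^ 2) ((n : ℤ) + r)) =
      qPoch (-q) (q ^ 2) L * q ^ (r ^ 2) *
        (qInv (q ^ 2) ((L : ℤ) - r) * qInv (q ^ 2) ((L : ℤ) + r)) := by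
  obtain ⟨s, rfl | rfl⟩ := r.eq_nat_or_neg
  · rw [sum_bailey_nat hq, ← Nat.cast_pow, zpow_natCast]
  · simp only [sub_neg_eq_add, ← sub_eq_add_neg, neg_sq]
    rw [mul_comm (qInv (q ^ 2) ((L : ℤ) + s)), ← Nat.cast_pow, zpow_natCast, ← sum_bailey_nat hq]
    exact Finset.sum_congr rfl fun n _ => by ring

/-- The Bailey step: convolution with `q^{n²}` and `1 / (q²; q²)_{L-n}` multiplies the `r`-th
coefficient by `q^{r²}`. -/
lemma sum_mul_bilat {q : ℂ} (hq : ‖q‖ < 1) (c : ℤ → ℂ) (L : ℕ) :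
    ∑ n ∈ Finset.range (L + 1), q ^ (n ^ 2) * qInv (q ^ 2) ((L : ℤ) - n) *
        (qPoch (-q) (q ^ 2) n * bilat (q ^ 2) c n n) =
      qPoch (-q) (q ^ 2) L * bilat (q ^ 2) (fun r => q ^ (r ^ 2) * c r) L L := by
  simp only [bilat, ← tsum_mul_left]
  rw [← Summable.tsum_finsetSum (f := fun (n : ℕ) (r : ℤ) => q ^ (n ^ 2) *
      qInv (q ^ 2) ((L : ℤ) - n) * (qPoch (-q) (q ^ 2) n *
        (c r * (qInv (q ^ 2) ((n : ℤ) - r) * qInv (q ^ 2) ((n : ℤ) + r))))) fun n _ =>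
    ((summable_bilat (q ^ 2) c n n).mul_left _).mul_left _]
  refine tsum_congr fun r => ?_
  have h := sum_bailey hq L r
  calc _ = c r * ∑ n ∈ Finset.range (L + 1), q ^ (n ^ 2) * qPoch (-q) (q ^ 2) n *
        qInv (q ^ 2) ((L : ℤ) - n) *
        (qInv (q ^ 2) ((n : ℤ) - r) * qInv (q ^ 2) ((n : ℤ) + r)) := by
        rw [Finset.mul_sum]
        exact Finset.sum_congr rfl fun n _ => by ring
    _ = _ := by rw [h]; ring

/-! ### The iterated sequence and the multiple series -/

/-- The sequence obtained from `q^{2L} (-q; q²)_L / (q⁴; q⁴)_L` by iterating convolution with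
`q^{n²}` and `1 / (q²; q²)_{L-n}`. -/
noncomputable def baileySeq (q : ℂ) : ℕ → ℕ → ℂ
  | 0, L => q ^ (2 * L) * qPoch (-q) (q ^ 2) L * (qPoch (q ^ 4) (q ^ 4) L)⁻¹
  | k + 1, L => ∑ n ∈ Finset.range (L + 1),
      q ^ (n ^ 2) * qInv (q ^ 2) ((L : ℤ) - n) * baileySeq q k n

lemma norm_pow_lt_one {q : ℂ} (hq : ‖q‖ < 1) {n : ℕ} (hn : n ≠ 0) : ‖q ^ n‖ < 1 := by
  rw [norm_pow]; exact pow_lt_one₀ (norm_nonneg q) hq hn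

/-- Each Bailey step adds `r²` to the exponent of the theta series. -/
lemma baileySeq_eq_bilat {q : ℂ} (hq : ‖q‖ < 1) (hq0 : q ≠ 0) (k L : ℕ) :
    baileySeq q k L =
      qPoch (-q) (q ^ 2) L * bilat (q ^ 2) (thetaTerm (q ^ (k + 2)) (q ^ 2)) L L := by
  induction k generalizing L with
  | zero =>
    rw [zero_add, bilat_thetaTerm_self (norm_pow_lt_one hq two_ne_zero) (pow_ne_zero 2 hq0),
      baileySeq, ← pow_mul, ← pow_mul]
    ring
  | succ k ih =>
    have h : thetaTerm (q ^ (k + 1 + 2)) (q ^ 2) =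
        fun r => q ^ (r ^ 2) * thetaTerm (q ^ (k + 2)) (q ^ 2) r := by
      funext r
      rw [thetaTerm, thetaTerm, show k + 1 + 2 = (k + 2) + 1 by ring, pow_succ, mul_zpow]
      ring
    rw [h, ← sum_mul_bilat hq, baileySeq]
    exact Finset.sum_congr rfl fun n _ => by rw [ih]

lemma tailSum_eq_sum_ite {k : ℕ} (n : Fin k → ℕ) (i : Fin k) :
    tailSum n i = ∑ j, if i ≤ j then n j else 0 := by
  rw [tailSum, ← Finset.sum_filter]
  congr 1
  ext j
  simp

lemma tailSum_cons_zero {k : ℕ} (a : ℕ) (n : Fin (k + 1) → ℕ) :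
    tailSum (Fin.cons a n : Fin (k + 2) → ℕ) 0 = a + tailSum n 0 := by
  simp [tailSum_eq_sum_ite, Fin.sum_univ_succ]

lemma tailSum_cons_succ {k : ℕ} (a : ℕ) (n : Fin k → ℕ) (i : Fin k) :
    tailSum (Fin.cons a n : Fin (k + 1) → ℕ) i.succ = tailSum n i := by
  simp [tailSum_eq_sum_ite, Fin.sum_univ_succ]

lemma lastIdx_succ (k : ℕ) : lastIdx (k + 2) (by omega) = (lastIdx (k + 1) (by omega)).succ := by
  ext; simp [lastIdx]

lemma hierarchyTerm_one (q : ℂ) (n : Fin 1 → ℕ) :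
    hierarchyTerm 1 le_rfl q n = q ^ (n 0 ^ 2) * baileySeq q 0 (n 0) := by
  have h0 : lastIdx 1 le_rfl = 0 := rfl
  have h1 : tailSum n 0 = n 0 := by simp [tailSum_eq_sum_ite]
  have h2 : Finset.Iio (0 : Fin 1) = ∅ := by ext j; simp
  simp only [hierarchyTerm, h0, h2, Finset.prod_empty, Fin.sum_univ_one, h1, baileySeq, pow_add]
  ring

lemma hierarchyTerm_cons (k : ℕ) (q : ℂ) (a : ℕ) (n : Fin (k + 1) → ℕ) :
    hierarchyTerm (k + 2) (by omega) q (Fin.cons a n) =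
      q ^ ((a + tailSum n 0) ^ 2) * qInv (q ^ 2) a * hierarchyTerm (k + 1) (by omega) q n := by
  have h : ∏ i ∈ Finset.Iio (lastIdx (k + 1) (by omega)).succ,
      qPoch (q ^ 2) (q ^ 2) ((Fin.cons a n : Fin (k + 2) → ℕ) i) =
      qPoch (q ^ 2) (q ^ 2) a * ∏ i ∈ Finset.Iio (lastIdx (k + 1) (by omega)),
        qPoch (q ^ 2) (q ^ 2) (n i) := by
    have e : ∀ {m : ℕ} (i : Fin m), Finset.Iio i = Finset.univ.filter fun j => j < i := by
      intro m i; ext j; simp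
    rw [e, e, Finset.prod_filter, Finset.prod_filter, Fin.prod_univ_succ]
    simp
  simp only [hierarchyTerm, lastIdx_succ, h, Fin.sum_univ_succ (n := k + 1), tailSum_cons_zero,
    tailSum_cons_succ, Fin.cons_succ, qInv_natCast, pow_add, div_eq_mul_inv, mul_inv]
  ring

lemma summable_of_norm_le_pow {q : ℂ} (hq : ‖q‖ < 1) {C : ℝ} {f : ℕ → ℂ}
    (hf : ∀ n, ‖f n‖ ≤ C * ‖q‖ ^ n) : Summable f :=
  Summable.of_norm_bounded ((summable_geometric_of_lt_one (norm_nonneg q) hq).mul_left C) hf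

lemma hasSum_tsum_mul_swap {β γ : Type*} {f : β → γ → ℂ} {h : γ → ℂ}
    (hfh : Summable fun x : β × γ => f x.1 x.2 * h x.2) (hf : ∀ c, Summable fun b => f b c) :
    HasSum (fun c => (∑' b, f b c) * h c) (∑' x : β × γ, f x.1 x.2 * h x.2) :=
  ((Equiv.prodComm γ β).hasSum_iff.mpr hfh.hasSum).prod_fiberwise
    fun c => (hf c).hasSum.mul_right (h c)

/-- `B N` is the sum of `H` over the level set `ν = N`, with all series absolutely convergent. This
is expressed by testing against bounded functions `g` of `ν`. -/
def HasLevelSums {T : Type*} (ν : T → ℕ) (H : T → ℂ) (B : ℕ → ℂ) : Prop :=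
  ∀ (g : ℕ → ℂ) (C : ℝ), (∀ N, ‖g N‖ ≤ C) →
    Summable (fun N => g N * B N) ∧ HasSum (fun t => g (ν t) * H t) (∑' N, g N * B N)

lemma HasLevelSums.summable {T : Type*} {ν : T → ℕ} {H : T → ℂ} {B : ℕ → ℂ}
    (h : HasLevelSums ν H B) : Summable B := by
  simpa using (h (fun _ => 1) 1 fun _ => by simp).1

lemma HasLevelSums.hasSum {T : Type*} {ν : T → ℕ} {H : T → ℂ} {B : ℕ → ℂ}
    (h : HasLevelSums ν H B) : HasSum H (∑' N, B N) := by
  simpa using (h (fun _ => 1) 1 fun _ => by simp).2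

/-- Summation of an absolutely convergent double series along the antidiagonals. -/
lemma hasSum_sum_range_of_summable {F : ℕ → ℕ → ℂ} (hF : Summable fun x : ℕ × ℕ => F x.1 x.2) :
    HasSum (fun N => ∑ m ∈ Finset.range (N + 1), F (N - m) m) (∑' x : ℕ × ℕ, F x.1 x.2) := by
  have h := (Finset.HasAntidiagonal.sigmaAntidiagonalEquivProd (A := ℕ)).hasSum_iff.mpr hF.hasSum
  refine h.sigma fun N => ?_
  have e : ∑ m ∈ Finset.range (N + 1), F (N - m) m =
      ∑ x ∈ Finset.HasAntidiagonal.antidiagonal N, F x.1 x.2 := by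
    rw [← Finset.Nat.sum_antidiagonal_swap, Finset.Nat.sum_antidiagonal_eq_sum_range_succ_mk]
    rfl
  rw [e, ← Finset.sum_coe_sort]
  exact hasSum_fintype _

/-- Adjoining a new outermost variable `a`, with weight `q^{(a + ν)²} e_a`, turns the level sums
`B` into `q^{N²} ∑_{m ≤ N} e_{N-m} B_m`. -/
lemma HasLevelSums.adjoin {q : ℂ} (hq : ‖q‖ < 1) {T : Type*} {ν : T → ℕ} {H : T → ℂ} {B : ℕ → ℂ}
    (h : HasLevelSums ν H B) {e : ℕ → ℂ} {D : ℝ} (he : ∀ a, ‖e a‖ ≤ D) :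
    HasLevelSums (fun x : ℕ × T => x.1 + ν x.2)
      (fun x => q ^ ((x.1 + ν x.2) ^ 2) * e x.1 * H x.2)
      (fun N => q ^ (N ^ 2) * ∑ m ∈ Finset.range (N + 1), e (N - m) * B m) := by
  intro g C hg
  have hD0 := (norm_nonneg _).trans (he 0)
  have hC0 := (norm_nonneg _).trans (hg 0)
  let w : ℕ → ℕ → ℂ := fun a N => g (a + N) * (q ^ ((a + N) ^ 2) * e a)
  have hw : ∀ a N, ‖w a N‖ ≤ C * D * ‖q‖ ^ a := fun a N => by
    have h1 : ‖q ^ ((a + N) ^ 2)‖ ≤ ‖q‖ ^ a := by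
      rw [norm_pow]
      exact pow_le_pow_of_le_one (norm_nonneg q) hq.le
        ((Nat.le_add_right a N).trans (Nat.le_self_pow two_ne_zero _))
    calc ‖w a N‖ = ‖g (a + N)‖ * (‖q ^ ((a + N) ^ 2)‖ * ‖e a‖) := by simp only [w, norm_mul]
      _ ≤ C * (‖q‖ ^ a * D) := by
        gcongr
        · exact hg _
        · exact he _
      _ = _ := by ring
  have hgeo := (summable_geometric_of_lt_one (norm_nonneg q) hq).mul_left (C * D)
  have hwsum : ∀ N, Summable fun a => w a N := fun N => summable_of_norm_le_pow hq (hw · N)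
  -- summing over `a` first leaves a bounded function of `ν`
  obtain ⟨-, hG⟩ := h (fun N => ∑' a, w a N) (∑' a : ℕ, C * D * ‖q‖ ^ a) fun N =>
    tsum_of_norm_bounded hgeo.hasSum (hw · N)
  have hdouble : Summable fun x : ℕ × ℕ => w x.1 x.2 * B x.2 := by
    refine Summable.of_norm_bounded (Summable.mul_of_nonneg hgeo h.summable.norm
      (fun a => by positivity) (fun N => norm_nonneg _)) fun x => ?_
    rw [norm_mul]
    gcongr
    exact hw _ _
  have hdiag := hasSum_sum_range_of_summable (F := fun a N => w a N * B N) hdouble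
  have hterm : ∀ N, ∑ m ∈ Finset.range (N + 1), w (N - m) m * B m =
      g N * (q ^ (N ^ 2) * ∑ m ∈ Finset.range (N + 1), e (N - m) * B m) := by
    intro N
    simp only [Finset.mul_sum]
    refine Finset.sum_congr rfl fun m hm => ?_
    have hm' : m ≤ N := by simpa [Nat.lt_succ_iff] using hm
    simp only [w, Nat.sub_add_cancel hm']
    ring
  simp only [hterm] at hdiag
  refine ⟨hdiag.summable, ?_⟩
  have hfull : Summable fun x : ℕ × T => w x.1 (ν x.2) * H x.2 := by
    refine Summable.of_norm_bounded (Summable.mul_of_nonneg hgeo h.hasSum.summable.norm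
      (fun a => by positivity) (fun t => norm_nonneg _)) fun x => ?_
    rw [norm_mul]
    gcongr
    exact hw _ _
  have hsum := hasSum_tsum_mul_swap (f := fun a t => w a (ν t)) hfull fun t => hwsum (ν t)
  rw [hdiag.tsum_eq, ← (hasSum_tsum_mul_swap hdouble hwsum).tsum_eq, hG.unique hsum]
  convert hfull.hasSum using 2 with x
  simp only [w]
  ring

/-- Summing out all variables with `N_1 = n_1 + ⋯ + n_k` held fixed leaves `q^{N_1²}` times the
iterated sequence. -/
lemma hasLevelSums_hierarchyTerm {q : ℂ} (hq : ‖q‖ < 1) (k : ℕ) :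
    HasLevelSums (fun n : Fin (k + 1) → ℕ => tailSum n 0)
      (hierarchyTerm (k + 1) (Nat.le_add_left 1 k) q)
      (fun N => q ^ (N ^ 2) * baileySeq q k N) := by
  have hQ : ‖q ^ 2‖ < 1 := norm_pow_lt_one hq two_ne_zero
  induction k with
  | zero =>
    intro g C hg
    have hs : Summable (fun N => g N * (q ^ (N ^ 2) * baileySeq q 0 N)) := by
      obtain ⟨A, hA⟩ := exists_norm_qPoch_le (-q) hQ
      obtain ⟨D, hD⟩ := exists_norm_qInv_le (norm_pow_lt_one hq four_ne_zero)
      have hA0 := (norm_nonneg _).trans (hA 0)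
      have hC0 := (norm_nonneg _).trans (hg 0)
      refine summable_of_norm_le_pow hq (C := C * (1 * A * D)) fun N => ?_
      have hD' := hD N
      rw [qInv_natCast] at hD'
      have h1 : ‖q ^ (2 * N)‖ ≤ 1 := by
        rw [norm_pow]; exact pow_le_one₀ (norm_nonneg q) hq.le
      have h2 : ‖q ^ (N ^ 2)‖ ≤ ‖q‖ ^ N := by
        rw [norm_pow]
        exact pow_le_pow_of_le_one (norm_nonneg q) hq.le (Nat.le_self_pow two_ne_zero N)
      calc ‖g N * (q ^ (N ^ 2) * baileySeq q 0 N)‖ =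
          ‖g N‖ * (‖q ^ (N ^ 2)‖ * (‖q ^ (2 * N)‖ * ‖qPoch (-q) (q ^ 2) N‖ *
            ‖(qPoch (q ^ 4) (q ^ 4) N)⁻¹‖)) := by simp only [baileySeq, norm_mul]
        _ ≤ C * (‖q‖ ^ N * (1 * A * D)) := by
          gcongr
          · exact hg N
          · exact hA N
        _ = _ := by ring
    refine ⟨hs, ?_⟩
    rw [← (Equiv.funUnique (Fin 1) ℕ).symm.hasSum_iff]
    convert hs.hasSum using 2 with m
    have h1 : tailSum (fun _ : Fin 1 => m) 0 = m := by simp [tailSum_eq_sum_ite]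
    simp only [Function.comp_apply]
    rw [hierarchyTerm_one]
    exact congrArg (fun N => g N * (q ^ (m ^ 2) * baileySeq q 0 m)) h1
  | succ k ih =>
    obtain ⟨D, hD⟩ := exists_norm_qInv_le hQ
    have h := ih.adjoin hq (e := fun a => qInv (q ^ 2) a) (D := D) fun a => hD a
    have hB : ∀ N : ℕ, ∑ m ∈ Finset.range (N + 1),
        qInv (q ^ 2) ((N - m : ℕ) : ℤ) * (q ^ (m ^ 2) * baileySeq q k m) =
          baileySeq q (k + 1) N := by
      intro N
      rw [baileySeq]
      refine Finset.sum_congr rfl fun m hm => ?_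
      have hm' : m ≤ N := by simpa [Nat.lt_succ_iff] using hm
      rw [Nat.cast_sub hm']
      ring
    simp only [hB] at h
    intro g C hg
    refine ⟨(h g C hg).1, ?_⟩
    rw [← (Fin.consEquiv fun _ : Fin (k + 2) => ℕ).hasSum_iff]
    convert (h g C hg).2 using 2 with x
    obtain ⟨a, n⟩ := x
    change g (tailSum (Fin.cons a n : Fin (k + 2) → ℕ) 0) *
      hierarchyTerm (k + 2) (by omega) q (Fin.cons a n) = _
    rw [hierarchyTerm_cons, tailSum_cons_zero]

lemma summable_norm_thetaTerm {q : ℂ} (hq : ‖q‖ < 1) (hq0 : q ≠ 0) (k : ℕ) :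
    Summable fun r => ‖thetaTerm (q ^ (k + 3)) (q ^ 2) r‖ := by
  have hgeo := summable_geometric_of_lt_one (norm_nonneg q) hq
  have hb : Summable fun r : ℤ => ‖q‖ ^ r.natAbs :=
    Summable.of_nat_of_neg (by simpa using hgeo) (by simpa using hgeo)
  refine Summable.of_nonneg_of_le (fun _ => norm_nonneg _) (fun r => ?_) hb
  have e : thetaTerm (q ^ (k + 3)) (q ^ 2) r = (-1) ^ r * q ^ ((k + 3) * r ^ 2 + 2 * r) := by
    rw [thetaTerm, mul_assoc, ← zpow_natCast, ← zpow_natCast, ← zpow_mul, ← zpow_mul,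
      ← zpow_add₀ hq0]
    push_cast
    rfl
  rw [e, norm_mul, norm_zpow, norm_zpow, norm_neg, norm_one, one_zpow, one_mul, ← zpow_natCast]
  refine zpow_le_zpow_right_of_le_one₀ (norm_pos_iff.mpr hq0) hq.le ?_
  -- `(k + 3) r² + 2 r ≥ 3 |r|² - 2 |r| ≥ |r|`
  have h1 : ((r.natAbs : ℤ)) ≤ r ^ 2 := by
    rw [← Int.natAbs_sq]; exact_mod_cast Nat.le_self_pow two_ne_zero _
  have h2 : -r ≤ (r.natAbs : ℤ) := by omega
  have h3 : 0 ≤ (k : ℤ) * r ^ 2 := by positivity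
  linarith

/-- The value of the multiple series, by letting `L → ∞` in the last convolution. -/
lemma tsum_baileySeq {q : ℂ} (hq : ‖q‖ < 1) (hq0 : q ≠ 0) (k : ℕ) :
    ∑' N, q ^ (N ^ 2) * baileySeq q k N =
      qPochInf (-q) (q ^ 2) / qPochInf (q ^ 2) (q ^ 2) *
        ∑' r, thetaTerm (q ^ (k + 3)) (q ^ 2) r := by
  have hQ : ‖q ^ 2‖ < 1 := norm_pow_lt_one hq two_ne_zero
  have hs := (hasLevelSums_hierarchyTerm hq k).summable
  obtain ⟨D, hD⟩ := exists_norm_qInv_le hQ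
  have h1 : Tendsto (fun L : ℕ => baileySeq q (k + 1) L) atTop
      (𝓝 (∑' N, (q ^ (N ^ 2) * baileySeq q k N) * (qPochInf (q ^ 2) (q ^ 2))⁻¹)) := by
    have e : ∀ L : ℕ, baileySeq q (k + 1) L =
        ∑' N : ℕ, (q ^ (N ^ 2) * baileySeq q k N) * qInv (q ^ 2) ((L : ℤ) - N) := by
      intro L
      rw [tsum_eq_sum (s := Finset.range (L + 1)), baileySeq]
      · exact Finset.sum_congr rfl fun n _ => by ring
      · intro N hN
        have : ¬ N < L + 1 := fun h => hN (Finset.mem_range.mpr h)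
        rw [qInv_of_neg _ (by omega), mul_zero]
    simp only [e]
    refine tendsto_tsum_of_dominated_convergence
      (bound := fun N => ‖q ^ (N ^ 2) * baileySeq q k N‖ * D) (hs.norm.mul_right _)
      (fun N => ?_) (Eventually.of_forall fun L N => ?_)
    · exact ((tendsto_qInv_atTop hQ).comp
        (tendsto_atTop_add_const_right _ (-(N : ℤ)) tendsto_natCast_atTop_atTop)).const_mul _
    · rw [norm_mul]
      gcongr
      exact hD _
  have h2 := (tendsto_qPoch (-q) hQ).mul (tendsto_bilat hQ (summable_norm_thetaTerm hq hq0 k))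
  have h3 := tendsto_nhds_unique (h1.congr fun L => baileySeq_eq_bilat hq hq0 (k + 1) L) h2
  rw [tsum_mul_right] at h3
  have h4 := qPochInf_ne_zero hQ hQ
  field_simp at h3 ⊢
  exact h3

lemma hasSum_hierarchyTerm_of_ne_zero {q : ℂ} (hq : ‖q‖ < 1) (hq0 : q ≠ 0) (k : ℕ) (hk : 1 ≤ k) :
    HasSum (hierarchyTerm k hk q)
      (qPochInf (-q) (q ^ 2) / qPochInf (q ^ 2) (q ^ 2) *
        (qPochInf (q ^ (2 * k + 4)) (q ^ (2 * k + 4)) *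
          qPochInf (q ^ k) (q ^ (2 * k + 4)) *
          qPochInf (q ^ (k + 4)) (q ^ (2 * k + 4)))) := by
  obtain ⟨k, rfl⟩ := Nat.exists_eq_add_of_le' hk
  have h := (hasLevelSums_hierarchyTerm hq k).hasSum
  rw [tsum_baileySeq hq hq0, tsum_thetaTerm (norm_pow_lt_one hq (by omega)) (pow_ne_zero _ hq0)
    (pow_ne_zero _ hq0) (summable_norm_thetaTerm hq hq0 k)] at h
  have e1 : q ^ (k + 3) / q ^ 2 = q ^ (k + 1) := by
    rw [show k + 3 = (k + 1) + 2 by ring, pow_add q (k + 1), mul_div_cancel_right₀ _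
      (pow_ne_zero _ hq0)]
  have e2 : q ^ (k + 3) * q ^ 2 = q ^ (k + 1 + 4) := by ring
  have e3 : (q ^ (k + 3)) ^ 2 = q ^ (2 * (k + 1) + 4) := by ring
  rwa [e1, e2, e3] at h

/-- For `q = 0` only the summand at the origin survives. -/
lemma hasSum_hierarchyTerm_zero (k : ℕ) (hk : 1 ≤ k) : HasSum (hierarchyTerm k hk 0) 1 := by
  have h0 : ∀ n : ℕ, qPoch 0 0 n = 1 := fun n => by simp [qPoch]
  have h1 : hierarchyTerm k hk 0 0 = 1 := by simp [hierarchyTerm, tailSum]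
  rw [← h1]
  refine hasSum_single 0 fun n hn => ?_
  obtain ⟨i, hi⟩ := Function.ne_iff.mp hn
  have h2 : tailSum n i ≠ 0 := by
    have : n i ≤ tailSum n i :=
      Finset.single_le_sum (f := n) (fun _ _ => Nat.zero_le _) (Finset.mem_Ici.mpr le_rfl)
    have : n i ≠ 0 := hi
    omega
  have h3 : ∑ i, tailSum n i ^ 2 ≠ 0 := fun h =>
    h2 (pow_eq_zero_iff two_ne_zero |>.mp (Finset.sum_eq_zero_iff.mp h i (Finset.mem_univ i)))
  rw [hierarchyTerm, zero_pow (by omega), zero_mul, zero_div]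

/-! ### Product identities -/

/-- Splitting an infinite factorial into its even- and odd-indexed factors. -/
lemma qPochInf_eq_mul_sq (a : ℂ) {q : ℂ} (hq : ‖q‖ < 1) :
    qPochInf a q = qPochInf a (q ^ 2) * qPochInf (a * q) (q ^ 2) := by
  have hQ : ‖q ^ 2‖ < 1 := norm_pow_lt_one hq two_ne_zero
  have h : ∀ N, qPoch a (q ^ 2) N * qPoch (a * q) (q ^ 2) N = qPoch a q (2 * N) := by
    intro N
    induction N with
    | zero => simp
    | succ N ih =>
      rw [show 2 * (N + 1) = 2 * N + 1 + 1 by ring, qPoch_succ, qPoch_succ, qPoch_succ,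
        qPoch_succ, ← ih]
      ring
  exact tendsto_nhds_unique ((tendsto_qPoch a hq).comp
    (tendsto_id.const_mul_atTop' (two_pos : 0 < 2)))
    (((tendsto_qPoch a hQ).mul (tendsto_qPoch (a * q) hQ)).congr h)

/-- The factorwise difference of two squares. -/
lemma qPochInf_mul_qPochInf_neg (a : ℂ) {q : ℂ} (hq : ‖q‖ < 1) :
    qPochInf a q * qPochInf (-a) q = qPochInf (a ^ 2) (q ^ 2) := by
  have h : ∀ N, qPoch a q N * qPoch (-a) q N = qPoch (a ^ 2) (q ^ 2) N := by
    intro N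
    rw [qPoch, qPoch, qPoch, ← Finset.prod_mul_distrib]
    exact Finset.prod_congr rfl fun j _ => by ring
  exact tendsto_nhds_unique (((tendsto_qPoch a hq).mul (tendsto_qPoch (-a) hq)).congr h)
    (tendsto_qPoch (a ^ 2) (norm_pow_lt_one hq two_ne_zero))

lemma qPochInf_prefactor {q : ℂ} (hq : ‖q‖ < 1) :
    qPochInf (q ^ 2) (q ^ 4) / qPochInf q q =
      qPochInf (-q) (q ^ 2) / qPochInf (q ^ 2) (q ^ 2) := by
  have hQ : ‖q ^ 2‖ < 1 := norm_pow_lt_one hq two_ne_zero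
  have h1 := qPochInf_mul_qPochInf_neg q hQ
  have h2 := qPochInf_eq_mul_sq q hq
  rw [← pow_mul] at h1
  rw [← pow_two] at h2
  rw [← h1, h2]
  have h3 := qPochInf_ne_zero hq hQ
  have h4 := qPochInf_ne_zero hQ hQ
  field_simp

lemma qPochInf_prefactor_mul {q : ℂ} (hq : ‖q‖ < 1) :
    qPochInf (-q) (q ^ 2) / qPochInf (q ^ 2) (q ^ 2) *
        (qPochInf (q ^ 8) (q ^ 8) * qPochInf (q ^ 2) (q ^ 8) * qPochInf (q ^ 6) (q ^ 8)) =
      qPochInf (-q) (q ^ 2) * qPochInf (-q ^ 4) (q ^ 4) := by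
  have hQ : ‖q ^ 2‖ < 1 := norm_pow_lt_one hq two_ne_zero
  have hQ4 : ‖q ^ 4‖ < 1 := norm_pow_lt_one hq four_ne_zero
  have h1 := qPochInf_eq_mul_sq (q ^ 2) hQ
  have h2 := qPochInf_eq_mul_sq (q ^ 2) hQ4
  have h3 := qPochInf_mul_qPochInf_neg (q ^ 4) hQ4
  have h4 := qPochInf_ne_zero hQ hQ
  simp only [← pow_mul, ← pow_add, Nat.reduceMul, Nat.reduceAdd] at h1 h2 h3
  rw [← h3]
  rw [div_mul_eq_mul_div, div_eq_iff h4]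
  linear_combination (-qPochInf (-q) (q ^ 2) * qPochInf (-q ^ 4) (q ^ 4)) * h1 -
    (qPochInf (-q) (q ^ 2) * qPochInf (q ^ 4) (q ^ 4) * qPochInf (-q ^ 4) (q ^ 4)) * h2

/-! ### Partitions into distinct parts -/

/-- The factor `q^b` of an admissible part `b`, and `0` for a part that must not occur. -/
noncomputable def partWeight (q : ℂ) (b : ℕ) : ℂ := if b = 0 ∨ b ≡ 2 [MOD 4] then 0 else q ^ b

lemma summable_norm_partWeight {q : ℂ} (hq : ‖q‖ < 1) : Summable fun b => ‖partWeight q b‖ := by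
  refine Summable.of_nonneg_of_le (fun _ => norm_nonneg _) (fun b => ?_)
    (summable_geometric_of_lt_one (norm_nonneg q) hq)
  rw [partWeight]
  split_ifs
  · rw [norm_zero]; positivity
  · rw [norm_pow]

lemma tprod_one_add_partWeight {q : ℂ} (hq : ‖q‖ < 1) :
    ∏' b, (1 + partWeight q b) =
      qPochInf (-q) (q ^ 4) * qPochInf (-q ^ 3) (q ^ 4) * qPochInf (-q ^ 4) (q ^ 4) := by
  have hQ : ‖q ^ 4‖ < 1 := norm_pow_lt_one hq four_ne_zero
  have h : ∀ N, qPoch (-q) (q ^ 4) N * qPoch (-q ^ 3) (q ^ 4) N * qPoch (-q ^ 4) (q ^ 4) N =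
      ∏ b ∈ Finset.range (4 * N + 1), (1 + partWeight q b) := by
    intro N
    induction N with
    | zero => simp [partWeight]
    | succ N ih =>
      have e1 : partWeight q (4 * N + 1) = q ^ (4 * N + 1) :=
        if_neg (by unfold Nat.ModEq; omega)
      have e2 : partWeight q (4 * N + 1 + 1) = 0 := if_pos (by unfold Nat.ModEq; omega)
      have e3 : partWeight q (4 * N + 1 + 1 + 1) = q ^ (4 * N + 3) :=
        if_neg (by unfold Nat.ModEq; omega)
      have e4 : partWeight q (4 * N + 1 + 1 + 1 + 1) = q ^ (4 * N + 4) :=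
        if_neg (by unfold Nat.ModEq; omega)
      rw [show 4 * (N + 1) + 1 = 4 * N + 1 + 1 + 1 + 1 + 1 by ring]
      rw [Finset.prod_range_succ, Finset.prod_range_succ, Finset.prod_range_succ,
        Finset.prod_range_succ, ← ih, e1, e2, e3, e4, qPoch_succ, qPoch_succ, qPoch_succ]
      ring
  have hm : Multipliable fun b => 1 + partWeight q b :=
    multipliable_one_add_of_summable (summable_norm_partWeight hq)
  have ht : Tendsto (fun N : ℕ => 4 * N + 1) atTop atTop :=
    tendsto_atTop_mono (fun N => by simp only [id]; omega) tendsto_id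
  exact tendsto_nhds_unique (hm.hasProd.tendsto_prod_nat.comp ht)
    ((((tendsto_qPoch _ hQ).mul (tendsto_qPoch _ hQ)).mul (tendsto_qPoch _ hQ)).congr h)

/-- Expanding `∏ (1 + partWeight q b)` over finite sets of parts; the sets that contribute are
those of the partitions counted by `distinctCount 2`. -/
lemma hasSum_distinctCount_two {q : ℂ} (hq : ‖q‖ < 1) :
    HasSum (fun m : ℕ => (distinctCount 2 m : ℂ) * q ^ m)
      (qPochInf (-q) (q ^ 4) * qPochInf (-q ^ 3) (q ^ 4) * qPochInf (-q ^ 4) (q ^ 4)) := by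
  have hs := summable_finsetProd_of_summable_norm (summable_norm_partWeight hq)
  have h := hs.hasSum
  rw [← tprod_one_add hs, tprod_one_add_partWeight hq] at h
  let A : ℕ → Type := fun m => {p : Nat.Partition m // p ∈ Finset.univ.filter
    fun p : Nat.Partition m => p.parts.Nodup ∧ ∀ b ∈ p.parts, ¬ b ≡ 2 [MOD 4]}
  have hA : ∀ {m} (p : A m), p.1.parts.Nodup ∧ ∀ b ∈ p.1.parts, ¬ b ≡ 2 [MOD 4] :=
    fun p => (Finset.mem_filter.mp p.2).2
  let toFin : (Σ m, A m) → Finset ℕ := fun x => ⟨x.2.1.parts, (hA x.2).1⟩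
  have hinj : Function.Injective toFin := by
    rintro ⟨m, p⟩ ⟨m', p'⟩ hpp
    have hparts : p.1.parts = p'.1.parts := congrArg Finset.val hpp
    obtain rfl : m = m' := by rw [← p.1.parts_sum, ← p'.1.parts_sum, hparts]
    have : p = p' := Subtype.ext (Nat.Partition.ext hparts)
    rw [this]
  have hrange : ∀ s ∉ Set.range toFin, ∏ b ∈ s, partWeight q b = 0 := by
    intro s hs
    by_contra hne
    have hgood : ∀ b ∈ s, ¬ (b = 0 ∨ b ≡ 2 [MOD 4]) := fun b hb hbad =>
      hne (Finset.prod_eq_zero hb (if_pos hbad))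
    refine hs ⟨⟨s.val.sum, ⟨⟨s.val, fun {b} hb => ?_, rfl⟩, ?_⟩⟩, rfl⟩
    · exact Nat.pos_of_ne_zero fun h0 => hgood b hb (Or.inl h0)
    · exact Finset.mem_filter.mpr ⟨Finset.mem_univ _, s.nodup, fun b hb h2 =>
        hgood b hb (Or.inr h2)⟩
  have hterm : ∀ x : Σ m, A m, ∏ b ∈ toFin x, partWeight q b = q ^ x.1 := by
    rintro ⟨m, p⟩
    have e : ∀ b ∈ toFin ⟨m, p⟩, partWeight q b = q ^ b := fun b hb =>
      if_neg (not_or.mpr ⟨(p.1.parts_pos hb).ne', (hA p).2 b hb⟩)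
    rw [Finset.prod_congr rfl e, Finset.prod_pow_eq_pow_sum]
    congr 1
    exact (congrArg Multiset.sum (Multiset.map_id' _)).trans p.1.parts_sum
  have h1 := (hinj.hasSum_iff hrange).mpr h
  rw [show (fun s => ∏ b ∈ s, partWeight q b) ∘ toFin = fun x => q ^ x.1 from funext hterm] at h1
  refine h1.sigma fun m => ?_
  have h3 := hasSum_fintype fun _ : {p : Nat.Partition m // p ∈ Finset.univ.filter
    fun p : Nat.Partition m => p.parts.Nodup ∧ ∀ b ∈ p.parts, ¬ b ≡ 2 [MOD 4]} => q ^ m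
  rwa [Finset.sum_const, nsmul_eq_mul, Finset.card_univ, Fintype.card_coe] at h3

/-! ### The hierarchy -/

lemma hasSum_hierarchyTerm {q : ℂ} (hq : ‖q‖ < 1) (k : ℕ) (hk : 1 ≤ k) :
    HasSum (hierarchyTerm k hk q)
      (qPochInf (-q) (q ^ 2) / qPochInf (q ^ 2) (q ^ 2) *
        (qPochInf (q ^ (2 * k + 4)) (q ^ (2 * k + 4)) *
          qPochInf (q ^ k) (q ^ (2 * k + 4)) *
          qPochInf (q ^ (k + 4)) (q ^ (2 * k + 4)))) := by
  rcases eq_or_ne q 0 with rfl | hq0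
  · have h : k ≠ 0 := by omega
    simpa [qPochInf, h] using hasSum_hierarchyTerm_zero k hk
  · exact hasSum_hierarchyTerm_of_ne_zero hq hq0 k hk

lemma hierarchyTerm_two (q : ℂ) (a b : ℕ) :
    hierarchyTerm 2 one_le_two q ![a, b] =
      q ^ (a ^ 2 + 2 * a * b + 2 * b ^ 2 + 2 * b) * qPoch (-q) (q ^ 2) b /
        (qPoch (q ^ 2) (q ^ 2) a * qPoch (q ^ 4) (q ^ 4) b) := by
  have h1 : tailSum ![b] 0 = b := by simp [tailSum_eq_sum_ite]
  have h := hierarchyTerm_cons 0 q a ![b]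
  rw [hierarchyTerm_one, h1, qInv_natCast] at h
  refine h.trans ?_
  rw [Matrix.cons_val_zero, baileySeq, div_eq_mul_inv, mul_inv]
  ring

theorem mainTheorem2 (q : ℂ) (hq : ‖q‖ < 1) :
    -- the hierarchy, for every `k ≥ 1`
    (∀ (k : ℕ) (hk : 1 ≤ k),
      HasSum (hierarchyTerm k hk q)
        (qPochInf (q ^ 2) (q ^ 4) / qPochInf q q *
          (qPochInf (q ^ (2 * k + 4)) (q ^ (2 * k + 4)) *
            qPochInf (q ^ k) (q ^ (2 * k + 4)) *
            qPochInf (q ^ (k + 4)) (q ^ (2 * k + 4)))) ∧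
      HasSum (hierarchyTerm k hk q)
        (qPochInf (-q) (q ^ 2) / qPochInf (q ^ 2) (q ^ 2) *
          (qPochInf (q ^ (2 * k + 4)) (q ^ (2 * k + 4)) *
            qPochInf (q ^ k) (q ^ (2 * k + 4)) *
            qPochInf (q ^ (k + 4)) (q ^ (2 * k + 4))))) ∧
    -- the case `k = 2`: its summand, its product side and the resulting identity
    (∀ a b : ℕ, hierarchyTerm 2 one_le_two q ![a, b] =
      q ^ (a ^ 2 + 2 * a * b + 2 * b ^ 2 + 2 * b) * qPoch (-q) (q ^ 2) b /
        (qPoch (q ^ 2) (q ^ 2) a * qPoch (q ^ 4) (q ^ 4) b)) ∧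
    qPochInf (q ^ 2) (q ^ 4) / qPochInf q q *
        (qPochInf (q ^ 8) (q ^ 8) * qPochInf (q ^ 2) (q ^ 8) * qPochInf (q ^ 6) (q ^ 8)) =
      qPochInf (-q) (q ^ 2) * qPochInf (-q ^ 4) (q ^ 4) ∧
    HasSum (fun n : ℕ × ℕ =>
        q ^ (n.1 ^ 2 + 2 * n.1 * n.2 + 2 * n.2 ^ 2 + 2 * n.2) * qPoch (-q) (q ^ 2) n.2 /
          (qPoch (q ^ 2) (q ^ 2) n.1 * qPoch (q ^ 4) (q ^ 4) n.2))
      (qPochInf (-q) (q ^ 2) * qPochInf (-q ^ 4) (q ^ 4)) ∧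
    qPochInf (-q) (q ^ 2) * qPochInf (-q ^ 4) (q ^ 4) =
      qPochInf (-q) (q ^ 4) * qPochInf (-q ^ 3) (q ^ 4) * qPochInf (-q ^ 4) (q ^ 4) ∧
    HasSum (fun m : ℕ => (distinctCount 2 m : ℂ) * q ^ m)
      (qPochInf (-q) (q ^ 4) * qPochInf (-q ^ 3) (q ^ 4) * qPochInf (-q ^ 4) (q ^ 4)) := by
  have h2 := hasSum_hierarchyTerm hq 2 one_le_two
  have hprod := qPochInf_prefactor_mul hq
  refine ⟨fun k hk => ⟨?_, hasSum_hierarchyTerm hq k hk⟩, hierarchyTerm_two q, ?_, ?_, ?_,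
    hasSum_distinctCount_two hq⟩
  · rw [qPochInf_prefactor hq]
    exact hasSum_hierarchyTerm hq k hk
  · rw [qPochInf_prefactor hq, hprod]
  · rw [← hprod]
    convert (finTwoArrowEquiv ℕ).symm.hasSum_iff.mpr h2 using 2 with n
    exact (hierarchyTerm_two q n.1 n.2).symm
  · have h := qPochInf_eq_mul_sq (-q) (norm_pow_lt_one hq two_ne_zero)
    rw [← pow_mul, show -q * q ^ 2 = -q ^ 3 by ring] at h
    rw [h]
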